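/- **Theorem 1.3 (Testing dimensionality).** For a real matrix $Y\in\mathbb{R}^{d\times p}$ and $\epsilon>0$ let the $\epsilon$-approximate rank be $$\mathrm{rank}_\epsilon(Y)=\min\{\mathrm{rank}(\hat Y):\hat Y\in\mathbb{R}^{d\times p},\ |Y_{ij}-\hat Y_{ij}|\le\epsilon\text{ for all }i,j\}.$$ A linear-query tester with query complexity $q$ consists of a random matrix $M\in\mathbb{R}^{q\times d}$, whose distribution does not depend on the input, and a (measurable) decision rule which, from the sketch $MY\in\mathbb{R}^{q\times p}$ alone, accepts or rejects the input $Y$; probabilities are over $M$. There is an absolute constant $C>0$ such that the following holds. Let $\epsilon,\delta\in(0,1)$ and let $d,k,p$ be positive integers with $k\ge 10\,\epsilon^2\log d$ (natural logarithm). Then there is a linear-query tester with query complexity at most $\lceil C\log(1/\delta)\rceil$, depending only on $\epsilon,\delta,d,k,p$, such that for all unit vectors $y_1,\dots,y_p\in\mathbb{R}^d$, with $Y\in\mathbb{R}^{d\times p}$ the matrix whose columns are $y_1,\dots,y_p$: * (Completeness) if $\mathrm{rank}(Y)\le k$, then the tester accepts $Y$ with probability at least $1-\delta$; * (Soundness)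 if $\mathrm{rank}_\epsilon(Y)\ge 20k/\epsilon^2$, then the tester rejects $Y$ with probability at least $1-\delta$. -/

import Mathlib

/-- The `d × p` real matrix whose columns are the vectors `y 0, …, y (p - 1)`. -/
def columnMatrix {d p : ℕ} (y : Fin p → EuclideanSpace ℝ (Fin d)) :
    Matrix (Fin d) (Fin p) ℝ :=
  Matrix.of fun i j => y j i

/-- The `ε`-approximate rank of `Y`: the least rank of a matrix `Z` of the same size that agrees
with `Y` up to `ε` in every entry. For `0 ≤ ε` the set is nonempty (it contains `Y.rank`), so the
infimum in `ℕ` is a minimum. -/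
noncomputable def approxRank {d p : ℕ} (ε : ℝ) (Y : Matrix (Fin d) (Fin p) ℝ) : ℕ :=
  sInf {r : ℕ | ∃ Z : Matrix (Fin d) (Fin p) ℝ, (∀ i j, |Y i j - Z i j| ≤ ε) ∧ Z.rank = r}

/-- A linear-query tester for real `d × p` matrices with `q` queries: a random query matrix
`M ∈ ℝ^{q × d}`, whose law does not depend on the input, and a decision rule, given by the
(Borel) set of those sketches `M * Y ∈ ℝ^{q × p}` on which the tester accepts.
The tester sees the input `Y` through the sketch `M * Y` only. -/
structure LinearTester (d p q : ℕ) where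
  /-- the law of the random query matrix `M`, seen as a family of its entries -/
  law : MeasureTheory.Measure (Fin q → Fin d → ℝ)
  isProbabilityMeasure_law : MeasureTheory.IsProbabilityMeasure law
  /-- the sketches on which the tester accepts -/
  accept : Set (Fin q → Fin p → ℝ)
  measurableSet_accept : MeasurableSet accept

/-- What the tester observes: the sketch `M * Y`. -/
def sketch {d p q : ℕ} (Y : Matrix (Fin d) (Fin p) ℝ) (M : Fin q → Fin d → ℝ) :
    Fin q → Fin p → ℝ :=
  fun a j => (Matrix.of M * Y) a j

/-- The probability, over the random query matrix, that the tester accepts `Y`. -/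
noncomputable def LinearTester.probAccept {d p q : ℕ} (T : LinearTester d p q)
    (Y : Matrix (Fin d) (Fin p) ℝ) : ℝ :=
  T.law.real {M | sketch Y M ∈ T.accept}

/-- The probability, over the random query matrix, that the tester rejects `Y`. -/
noncomputable def LinearTester.probReject {d p q : ℕ} (T : LinearTester d p q)
    (Y : Matrix (Fin d) (Fin p) ℝ) : ℝ :=
  T.law.real {M | sketch Y M ∉ T.accept}

open scoped BigOperators

/-! The statistic is `w = rademacherWidth n Y`, the mean of `‖bᵀY‖∞` for `b` a normalized sum of `n`
random sign vectors, a substitute for a Gaussian vector. If `Y` has rank at most `k`, each `⟨b,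
y_j⟩` is bounded by the length of the projection of `b` to the column span; its mean square is the
rank, so `w ≤ √k` (`rademacherWidth_le_sqrt_rank`).

Conversely, small `w` forces small approximate rank. By `exists_signs_forall_ker_sqrt_le`, the
common orthogonal complement of some `n` sign vectors meets the absolutely convex hull of the
columns within Euclidean radius `2√3 w / √n`. If this is at most `ε`, Hahn–Banach
(`approxRank_le_rank_of_ker`) gives an entrywise `ε`-approximation of rank at most `n`. With `n`
just below `20k/ε²`, soundness inputs must have `w ≥ (5/4)√k`.

Each row of the sketch yields one sample of `‖bᵀY‖∞`. By Efron–Stein its variance is at most 2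
whatever the dimensions, so truncation at `10√k` barely lowers the mean, and Hoeffding's inequality
separates the two cases with `O(log(1/δ))` rows. -/

/-- The real sign `±1` encoded by a Boolean. -/
def boolSign (b : Bool) : ℝ := if b then 1 else -1

@[simp] lemma boolSign_not (b : Bool) : boolSign (!b) = -boolSign b := by
  cases b <;> simp [boolSign]

@[simp] lemma boolSign_sq (b : Bool) : boolSign b ^ 2 = 1 := by
  cases b <;> simp [boolSign]

@[simp] lemma abs_boolSign (b : Bool) : |boolSign b| = 1 := by
  cases b <;> simp [boolSign]

/-! ### Rademacher sums on the discrete cube: Efron–Stein, Khinchine, variance of a maximum. -/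

section Cube

variable {ι : Type*}

/-- The Rademacher sum with coefficients `c`. -/
def rademacherSum [Fintype ι] (c : ι → ℝ) (ω : ι → Bool) : ℝ := ∑ i, boolSign (ω i) * c i

lemma rademacherSum_not [Fintype ι] (c : ι → ℝ) (ω : ι → Bool) :
    rademacherSum c (fun i => !ω i) = -rademacherSum c ω := by
  simp [rademacherSum]

variable [DecidableEq ι]

/-- Flip the `i`-th coordinate of a point of the discrete cube. -/
def flipAt (i : ι) (ω : ι → Bool) : ι → Bool := Function.update ω i (!ω i)

@[simp] lemma flipAt_self (i : ι) (ω : ι → Bool) : flipAt i ω i = !ω i := by simp [flipAt]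

lemma flipAt_of_ne {i j : ι} (h : j ≠ i) (ω : ι → Bool) : flipAt i ω j = ω j := by
  simp [flipAt, h]

@[simp] lemma flipAt_flipAt (i : ι) (ω : ι → Bool) : flipAt i (flipAt i ω) = ω := by
  ext j
  by_cases h : j = i
  · subst h; simp
  · simp [flipAt_of_ne h]

lemma flipAt_comm (i j : ι) (ω : ι → Bool) :
    flipAt i (flipAt j ω) = flipAt j (flipAt i ω) := by
  by_cases hij : i = j
  · rw [hij]
  ext k
  by_cases hi : k = i
  · subst hi; simp [flipAt_of_ne hij]
  · by_cases hj : k = j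
    · subst hj; simp [flipAt_of_ne hi]
    · simp [flipAt_of_ne hi, flipAt_of_ne hj]

lemma apply_eq_of_comp_flipAt_eq [Fintype ι] {g : (ι → Bool) → ℝ}
    (hg : ∀ i ω, g (flipAt i ω) = g ω) (ω ω' : ι → Bool) : g ω = g ω' := by
  have key : ∀ (s : Finset ι) (ω : ι → Bool), (∀ i ∉ s, ω i = ω' i) → g ω = g ω' := by
    intro s
    induction s using Finset.induction_on with
    | empty =>
      intro ω h
      congr 1
      ext i
      simp [h i]
    | insert a s ha ih =>
      intro ω h
      by_cases hωa : ω a = ω' a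
      · refine ih ω fun i hi => ?_
        by_cases hia : i = a
        · rw [hia, hωa]
        · exact h i (by simp [hia, hi])
      · rw [← hg a ω]
        refine ih _ fun i hi => ?_
        by_cases hia : i = a
        · subst hia
          rw [flipAt_self]
          cases h1 : ω i <;> cases h2 : ω' i <;> simp_all
        · rw [flipAt_of_ne hia]
          exact h i (by simp [hia, hi])
  exact key Finset.univ ω (by simp)

variable [Fintype ι]

lemma expect_comp_flipAt (i : ι) (f : (ι → Bool) → ℝ) :
    𝔼 ω, f (flipAt i ω) = 𝔼 ω, f ω :=
  Fintype.expect_equiv (Function.Involutive.toPerm (flipAt i) (flipAt_flipAt i)) _ _ fun _ => rfl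

/-- The Efron–Stein (Poincaré) inequality on the discrete cube. -/
theorem expect_sq_le_sq_expect_add (f : (ι → Bool) → ℝ) :
    𝔼 ω, f ω ^ 2 ≤ (𝔼 ω, f ω) ^ 2 + (∑ i, 𝔼 ω, (f ω - f (flipAt i ω)) ^ 2) / 4 := by
  -- `g` is `f` averaged over the coordinates in `s`. By convexity averaging does not increase any
  -- flip energy, and by the parallelogram identity each step costs exactly a quarter of one energy
  -- of the current `g`.
  have key : ∀ s : Finset ι, ∃ g : (ι → Bool) → ℝ, 𝔼 ω, g ω = 𝔼 ω, f ω ∧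
      (∀ i ∈ s, ∀ ω, g (flipAt i ω) = g ω) ∧
      (∀ i, 𝔼 ω, (g ω - g (flipAt i ω)) ^ 2 ≤ 𝔼 ω, (f ω - f (flipAt i ω)) ^ 2) ∧
      𝔼 ω, f ω ^ 2 ≤ 𝔼 ω, g ω ^ 2 + (∑ i ∈ s, 𝔼 ω, (f ω - f (flipAt i ω)) ^ 2) / 4 := by
    intro s
    induction s using Finset.induction_on with
    | empty => exact ⟨f, rfl, by simp, fun _ => le_rfl, by simp⟩
    | insert a s ha ih =>
      obtain ⟨g, hE, hinv, henergy, hvar⟩ := ih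
      refine ⟨fun ω => (g ω + g (flipAt a ω)) / 2, ?_, ?_, ?_, ?_⟩
      · rw [← Finset.expect_div, Finset.expect_add_distrib, expect_comp_flipAt, hE]
        ring
      · intro i hi ω
        rcases Finset.mem_insert.1 hi with rfl | hi
        · simp [add_comm]
        · simp only [flipAt_comm a i, hinv i hi]
      · intro i
        refine le_trans ?_ (henergy i)
        calc 𝔼 ω, ((g ω + g (flipAt a ω)) / 2
                - (g (flipAt i ω) + g (flipAt a (flipAt i ω))) / 2) ^ 2
            ≤ 𝔼 ω, ((g ω - g (flipAt i ω)) ^ 2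
                + (g (flipAt a ω) - g (flipAt i (flipAt a ω))) ^ 2) / 2 := by
              refine Finset.expect_le_expect fun ω _ => ?_
              rw [flipAt_comm a i]
              nlinarith [sq_nonneg ((g ω - g (flipAt i ω))
                - (g (flipAt a ω) - g (flipAt i (flipAt a ω))))]
          _ = 𝔼 ω, (g ω - g (flipAt i ω)) ^ 2 := by
              rw [← Finset.expect_div, Finset.expect_add_distrib,
                expect_comp_flipAt a (fun ω => (g ω - g (flipAt i ω)) ^ 2)]
              ring
      · rw [Finset.sum_insert ha]
        have h1 : 𝔼 ω, ((g ω + g (flipAt a ω)) / 2) ^ 2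
            = 𝔼 ω, g ω ^ 2 - (𝔼 ω, (g ω - g (flipAt a ω)) ^ 2) / 4 := by
          have h2 : 𝔼 ω, g ω ^ 2 = 𝔼 ω, (g ω ^ 2 + g (flipAt a ω) ^ 2) / 2 := by
            rw [← Finset.expect_div, Finset.expect_add_distrib,
              expect_comp_flipAt a (fun ω => g ω ^ 2)]
            ring
          rw [h2, Finset.expect_div, ← Finset.expect_sub_distrib]
          exact Finset.expect_congr rfl fun ω _ => by ring
        have h3 := henergy a
        rw [h1]
        linarith
  obtain ⟨g, hE, hinv, -, hvar⟩ := key Finset.univ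
  have hconst : ∀ ω, g ω = 𝔼 ω, f ω := by
    intro ω
    rw [← hE]
    conv_rhs => rw [Finset.expect_congr rfl fun ω' _ =>
      apply_eq_of_comp_flipAt_eq (fun i => hinv i (Finset.mem_univ i)) ω' ω]
    simp
  simpa [hconst] using hvar

lemma rademacherSum_sub_flipAt (c : ι → ℝ) (i : ι) (ω : ι → Bool) :
    rademacherSum c ω - rademacherSum c (flipAt i ω) = 2 * boolSign (ω i) * c i := by
  rw [rademacherSum, rademacherSum, ← Finset.sum_sub_distrib,
    Finset.sum_eq_single i (fun j _ hj => by rw [flipAt_of_ne hj, sub_self]) (by simp)]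
  simp
  ring

/-- Averaging over the flip of the new sign kills the odd powers in the binomial expansion; the
cross term `6 c² S²` of the fourth moment is what the constant 3 absorbs. -/
lemma expect_sum_moments (c : ι → ℝ) (s : Finset ι) :
    𝔼 ω : ι → Bool, (∑ i ∈ s, boolSign (ω i) * c i) ^ 2 = ∑ i ∈ s, c i ^ 2 ∧
    𝔼 ω : ι → Bool, (∑ i ∈ s, boolSign (ω i) * c i) ^ 4 ≤ 3 * (∑ i ∈ s, c i ^ 2) ^ 2 := by
  induction s using Finset.induction_on with
  | empty => simp
  | insert a s ha ih =>
    set S : (ι → Bool) → ℝ := fun ω => ∑ i ∈ s, boolSign (ω i) * c i with hS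
    have hflip : ∀ ω, S (flipAt a ω) = S ω := fun ω =>
      Finset.sum_congr rfl fun i hi => by rw [flipAt_of_ne (by rintro rfl; exact ha hi)]
    have hsymm : ∀ m : ℕ, 𝔼 ω : ι → Bool, (∑ i ∈ insert a s, boolSign (ω i) * c i) ^ m
        = 𝔼 ω, ((boolSign (ω a) * c a + S ω) ^ m + (-(boolSign (ω a) * c a) + S ω) ^ m) / 2 := by
      intro m
      simp only [Finset.sum_insert ha]
      rw [← Finset.expect_div, Finset.expect_add_distrib]
      have := expect_comp_flipAt a (fun ω => (boolSign (ω a) * c a + S ω) ^ m)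
      simp only [hflip, flipAt_self, boolSign_not, neg_mul] at this
      rw [this]
      simp only [hS]
      ring
    have hsq : ∀ ω : ι → Bool, (boolSign (ω a) * c a) ^ 2 = c a ^ 2 := fun ω => by
      rw [mul_pow, boolSign_sq, one_mul]
    rw [hsymm, hsymm, Finset.sum_insert ha]
    constructor
    · have : ∀ ω, ((boolSign (ω a) * c a + S ω) ^ 2 + (-(boolSign (ω a) * c a) + S ω) ^ 2) / 2
          = c a ^ 2 + S ω ^ 2 := fun ω => by rw [← hsq ω]; ring
      simp only [this]
      rw [Finset.expect_add_distrib, Fintype.expect_const, ih.1]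
    · have : ∀ ω, ((boolSign (ω a) * c a + S ω) ^ 4 + (-(boolSign (ω a) * c a) + S ω) ^ 4) / 2
          = (c a ^ 2) ^ 2 + 6 * c a ^ 2 * S ω ^ 2 + S ω ^ 4 := fun ω => by rw [← hsq ω]; ring
      simp only [this]
      rw [Finset.expect_add_distrib, Finset.expect_add_distrib, Fintype.expect_const,
        ← Finset.mul_expect, ih.1]
      nlinarith [ih.2, sq_nonneg (c a ^ 2)]

lemma expect_rademacherSum_sq (c : ι → ℝ) : 𝔼 ω, rademacherSum c ω ^ 2 = ∑ i, c i ^ 2 :=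
  (expect_sum_moments c Finset.univ).1

lemma expect_rademacherSum_pow_four_le (c : ι → ℝ) :
    𝔼 ω, rademacherSum c ω ^ 4 ≤ 3 * (∑ i, c i ^ 2) ^ 2 :=
  (expect_sum_moments c Finset.univ).2

/-- Khinchine's inequality between the first and the second moment, with constant `1 / √3`. -/
theorem sqrt_sum_sq_le_expect_abs (c : ι → ℝ) :
    √(∑ i, c i ^ 2) ≤ √3 * 𝔼 ω, |rademacherSum c ω| := by
  set σ := √(∑ i, c i ^ 2) with hσ
  have hσ2 : σ ^ 2 = ∑ i, c i ^ 2 := Real.sq_sqrt (Finset.sum_nonneg fun i _ => sq_nonneg _)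
  have h2 := expect_rademacherSum_sq c
  have h4 := expect_rademacherSum_pow_four_le c
  rw [← hσ2] at h2 h4
  have h3 : √3 ^ 2 = (3 : ℝ) := Real.sq_sqrt (by norm_num)
  have h3pos : 0 < √(3 : ℝ) := by positivity
  have hE : 0 ≤ 𝔼 ω, |rademacherSum c ω| := Finset.expect_nonneg fun _ _ => abs_nonneg _
  rcases (show 0 ≤ σ from Real.sqrt_nonneg _).eq_or_lt with h0 | hpos
  · rw [← h0]
    positivity
  -- The difference of the two sides has a double root at `u = √3 σ`; averaging this bound needs
  -- only the second and fourth moments.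
  have hpt : ∀ u : ℝ, 0 ≤ u → 9 * σ ^ 2 * u ^ 2 - u ^ 4 ≤ 6 * √3 * σ ^ 3 * u := by
    intro u hu
    have : 6 * √3 * σ ^ 3 * u - (9 * σ ^ 2 * u ^ 2 - u ^ 4)
        = u * (u - √3 * σ) ^ 2 * (u + 2 * √3 * σ) := by
      have h33 : √3 ^ 3 = 3 * √(3 : ℝ) := by rw [pow_succ, h3]
      ring_nf
      rw [h33, h3]
      ring
    nlinarith [mul_nonneg (mul_nonneg hu (sq_nonneg (u - √3 * σ)))
      (by positivity : 0 ≤ u + 2 * √3 * σ)]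
  have hsum : 9 * σ ^ 2 * 𝔼 ω, rademacherSum c ω ^ 2 - 𝔼 ω, rademacherSum c ω ^ 4
      ≤ 6 * √3 * σ ^ 3 * 𝔼 ω, |rademacherSum c ω| := by
    rw [Finset.mul_expect, Finset.mul_expect, ← Finset.expect_sub_distrib]
    refine Finset.expect_le_expect fun ω _ => ?_
    have := hpt _ (abs_nonneg (rademacherSum c ω))
    rwa [sq_abs, pow_abs, abs_of_nonneg (by positivity : 0 ≤ rademacherSum c ω ^ 4)] at this
  rw [h2] at hsum
  have h5 : 6 * σ ^ 3 * σ ≤ 6 * σ ^ 3 * (√3 * 𝔼 ω, |rademacherSum c ω|) := by nlinarith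
  exact le_of_mul_le_mul_left h5 (by positivity)

/-- The maximum of finitely many Rademacher sums with coefficient vectors in the unit ball has
variance at most `2`. -/
theorem expect_norm_rademacherSum_sq_le {κ : Type*} [Fintype κ] [Nonempty κ] (c : κ → ι → ℝ)
    (hc : ∀ j, ∑ i, c j i ^ 2 ≤ 1) :
    𝔼 ω, ‖fun j => rademacherSum (c j) ω‖ ^ 2
      ≤ (𝔼 ω, ‖fun j => rademacherSum (c j) ω‖) ^ 2 + 2 := by
  set f : (ι → Bool) → ℝ := fun ω => ‖fun j => rademacherSum (c j) ω‖ with hf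
  have hES := expect_sq_le_sq_expect_add f
  -- A flip exchanges rises and drops of `f`, so it is enough to control the drops.
  have hpos : ∀ i, 𝔼 ω, (f ω - f (flipAt i ω)) ^ 2
      = 2 * 𝔼 ω, (max (f ω - f (flipAt i ω)) 0) ^ 2 := by
    intro i
    have h1 := expect_comp_flipAt i (fun ω => (max (f ω - f (flipAt i ω)) 0) ^ 2)
    simp only [flipAt_flipAt] at h1
    have h2 : ∀ ω, (f ω - f (flipAt i ω)) ^ 2
        = (max (f ω - f (flipAt i ω)) 0) ^ 2 + (max (f (flipAt i ω) - f ω) 0) ^ 2 := by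
      intro ω
      rcases le_total (f ω) (f (flipAt i ω)) with h | h
      · rw [max_eq_right (by linarith), max_eq_left (by linarith)]; ring
      · rw [max_eq_left (by linarith), max_eq_right (by linarith)]; ring
    simp only [h2]
    rw [Finset.expect_add_distrib, h1]
    ring
  have hbound : ∀ ω, ∑ i, (max (f ω - f (flipAt i ω)) 0) ^ 2 ≤ 4 := by
    intro ω
    -- An index attaining the maximum at `ω` works for every `i`: a drop of the maximum is at most
    -- the change of this single sum.
    obtain ⟨j, hj⟩ := Finite.exists_max fun j => ‖rademacherSum (c j) ω‖
    have hfω : f ω ≤ |rademacherSum (c j) ω| := (pi_norm_le_iff_of_nonempty _).2 hj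
    calc ∑ i, (max (f ω - f (flipAt i ω)) 0) ^ 2 ≤ ∑ i, 4 * c j i ^ 2 := by
          refine Finset.sum_le_sum fun i _ => ?_
          have h1 : |rademacherSum (c j) (flipAt i ω)| ≤ f (flipAt i ω) :=
            norm_le_pi_norm (fun j => rademacherSum (c j) (flipAt i ω)) j
          have h2 := abs_sub_abs_le_abs_sub (rademacherSum (c j) ω)
            (rademacherSum (c j) (flipAt i ω))
          rw [rademacherSum_sub_flipAt, abs_mul, abs_mul, abs_boolSign, abs_two, mul_one] at h2
          have h3 : max (f ω - f (flipAt i ω)) 0 ≤ 2 * |c j i| :=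
            max_le (by linarith) (by positivity)
          calc _ ≤ (2 * |c j i|) ^ 2 := by gcongr
            _ = 4 * c j i ^ 2 := by rw [mul_pow, sq_abs]; ring
      _ ≤ 4 := by rw [← Finset.mul_sum]; linarith [hc j]
  have htotal : ∑ i, 𝔼 ω, (f ω - f (flipAt i ω)) ^ 2 ≤ 8 := by
    simp only [hpos]
    rw [← Finset.mul_sum, ← Finset.expect_sum_comm]
    have := Finset.expect_le (s := Finset.univ) Finset.univ_nonempty fun ω _ => hbound ω
    linarith
  linarith

end Cube

/-! ### Symmetrization and contraction for expected suprema. -/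

section Comparison

variable {A T : Type*} [Fintype A]

lemma expect_fin_succ {n : ℕ} (f : (Fin (n + 1) → A) → ℝ) :
    𝔼 a, f a = 𝔼 a₀, 𝔼 a : Fin n → A, f (Fin.cons a₀ a) := by
  rw [← Finset.expect_product', Finset.univ_product_univ]
  exact (Fintype.expect_equiv (Fin.consEquiv fun _ => A) _ _ fun _ => rfl).symm

variable [Nonempty A] [Nonempty T]

/-- One step of symmetrization and contraction: for a symmetric random linear functional `ℓ`,
the penalty `𝔼 |ℓ| - |ℓ|` may be replaced by `2 ℓ` under the expected supremum. -/
lemma expect_iSup_add_sub_abs_le (ν : A ≃ A) (ℓ : A → T → ℝ)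
    (hν : ∀ a x, ℓ (ν a) x = -ℓ a x) (hℓ : ∃ C, ∀ a x, |ℓ a x| ≤ C)
    (F : T → ℝ) (hF : ∃ C, ∀ x, |F x| ≤ C) :
    𝔼 a, ⨆ x, (F x + (𝔼 a', |ℓ a' x| - |ℓ a x|)) ≤ 𝔼 a, ⨆ x, (F x + 2 * ℓ a x) := by
  obtain ⟨C, hC⟩ := hℓ
  obtain ⟨D, hD⟩ := hF
  set s : A → ℝ := fun a => ⨆ x, (F x + 2 * ℓ a x)
  have hs : ∀ a x, F x + 2 * ℓ a x ≤ s a := fun a x =>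
    le_ciSup (f := fun x => F x + 2 * ℓ a x) ⟨D + 2 * C, by
      rintro _ ⟨x, rfl⟩
      linarith [(abs_le.1 (hC a x)).2, (abs_le.1 (hD x)).2]⟩ x
  set u : A → ℝ := fun a => ⨆ x, (F x + 2 * |ℓ a x|)
  have hu : ∀ a x, F x + 2 * |ℓ a x| ≤ u a := fun a x =>
    le_ciSup (f := fun x => F x + 2 * |ℓ a x|) ⟨D + 2 * C, by
      rintro _ ⟨x, rfl⟩
      linarith [hC a x, (abs_le.1 (hD x)).2]⟩ x
  set v : A → ℝ := fun a => ⨆ x, (F x - 2 * |ℓ a x|)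
  have hv : ∀ a x, F x - 2 * |ℓ a x| ≤ v a := fun a x =>
    le_ciSup (f := fun x => F x - 2 * |ℓ a x|) ⟨D, by
      rintro _ ⟨x, rfl⟩
      linarith [abs_nonneg (ℓ a x), (abs_le.1 (hD x)).2]⟩ x
  have hEsν : 𝔼 a, s (ν a) = 𝔼 a, s a := Fintype.expect_equiv ν _ _ fun _ => rfl
  -- `s a` and `s (ν a)` are the suprema with `+2ℓ` and `-2ℓ`: `u` is at most their maximum and `v`
  -- at most their minimum.
  have huv : ∀ a, u a + v a ≤ s a + s (ν a) := by
    intro a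
    have hvle : v a ≤ min (s a) (s (ν a)) := ciSup_le fun x => by
      have h1 := hs a x
      have h2 := hs (ν a) x
      rw [hν] at h2
      exact le_min (by linarith [neg_abs_le (ℓ a x)]) (by linarith [le_abs_self (ℓ a x)])
    have hule : u a ≤ max (s a) (s (ν a)) := ciSup_le fun x => by
      have h1 := hs a x
      have h2 := hs (ν a) x
      rw [hν] at h2
      rcases abs_cases (ℓ a x) with ⟨h, -⟩ | ⟨h, -⟩ <;> rw [h]
      · exact le_max_of_le_left h1
      · exact le_max_of_le_right h2
    linarith [min_add_max (s a) (s (ν a))]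
  have hstep : ∀ a, ⨆ x, (F x + (𝔼 a', |ℓ a' x| - |ℓ a x|)) ≤ 𝔼 a', (u a' + v a) / 2 := by
    intro a
    refine ciSup_le fun x => ?_
    have : F x + (𝔼 a', |ℓ a' x| - |ℓ a x|) = 𝔼 a', (F x + |ℓ a' x| - |ℓ a x|) := by
      rw [Finset.expect_sub_distrib, Finset.expect_add_distrib, Fintype.expect_const,
        Fintype.expect_const]
      ring
    rw [this]
    exact Finset.expect_le_expect fun a' _ => by linarith [hu a' x, hv a x]
  calc 𝔼 a, ⨆ x, (F x + (𝔼 a', |ℓ a' x| - |ℓ a x|))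
      ≤ 𝔼 a, 𝔼 a', (u a' + v a) / 2 := Finset.expect_le_expect fun a _ => hstep a
    _ = (𝔼 a, (u a + v a)) / 2 := by
      simp only [← Finset.expect_div, Finset.expect_add_distrib, Fintype.expect_const]
    _ ≤ (𝔼 a, (s a + s (ν a))) / 2 := by
      have := Finset.expect_le_expect (s := Finset.univ) fun a _ => huv a
      linarith
    _ = 𝔼 a, s a := by rw [Finset.expect_add_distrib, hEsν]; ring

/-- Replacing every penalty `𝔼 |ℓ| - |ℓ|` in a sum of independent copies by `2 ℓ` does not
decrease the expected supremum. -/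
lemma expect_iSup_sum_sub_abs_le (ν : A ≃ A) (ℓ : A → T → ℝ)
    (hν : ∀ a x, ℓ (ν a) x = -ℓ a x) (hℓ : ∃ C, ∀ a x, |ℓ a x| ≤ C) (n : ℕ)
    (F : T → ℝ) (hF : ∃ C, ∀ x, |F x| ≤ C) :
    𝔼 a : Fin n → A, ⨆ x, (F x + ∑ i, (𝔼 a', |ℓ a' x| - |ℓ (a i) x|))
      ≤ 𝔼 a : Fin n → A, ⨆ x, (F x + ∑ i, 2 * ℓ (a i) x) := by
  obtain ⟨C, hC⟩ := hℓ
  induction n generalizing F with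
  | zero => simp
  | succ n ih =>
    obtain ⟨D, hD⟩ := hF
    rw [expect_fin_succ, expect_fin_succ]
    simp only [Fin.sum_univ_succ, Fin.cons_zero, Fin.cons_succ]
    -- For fixed `a₀` its penalty is absorbed into `F`, which is why the induction varies `F`;
    -- afterwards the tail is absorbed and `a₀` is treated.
    calc _ = 𝔼 a₀, 𝔼 a : Fin n → A, ⨆ x, ((F x + (𝔼 a', |ℓ a' x| - |ℓ a₀ x|))
            + ∑ i, (𝔼 a', |ℓ a' x| - |ℓ (a i) x|)) := by simp only [add_assoc]
      _ ≤ 𝔼 a₀, 𝔼 a : Fin n → A, ⨆ x, ((F x + (𝔼 a', |ℓ a' x| - |ℓ a₀ x|))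
            + ∑ i, 2 * ℓ (a i) x) := by
          refine Finset.expect_le_expect fun a₀ _ => ih _ ⟨D + C, fun x => ?_⟩
          have h1 : 0 ≤ 𝔼 a', |ℓ a' x| := Finset.expect_nonneg fun _ _ => abs_nonneg _
          have h2 : 𝔼 a', |ℓ a' x| ≤ C :=
            Finset.expect_le Finset.univ_nonempty fun a' _ => hC a' x
          have h3 := hC a₀ x
          have h4 := abs_nonneg (ℓ a₀ x)
          have h5 := abs_le.1 (hD x)
          rw [abs_le]
          constructor <;> linarith
      _ = 𝔼 a : Fin n → A, 𝔼 a₀, ⨆ x, ((F x + ∑ i, 2 * ℓ (a i) x)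
            + (𝔼 a', |ℓ a' x| - |ℓ a₀ x|)) := by
          rw [Finset.expect_comm]
          simp only [add_right_comm]
      _ ≤ 𝔼 a : Fin n → A, 𝔼 a₀, ⨆ x, ((F x + ∑ i, 2 * ℓ (a i) x) + 2 * ℓ a₀ x) := by
          refine Finset.expect_le_expect fun a _ =>
            expect_iSup_add_sub_abs_le ν ℓ hν ⟨C, hC⟩ _ ⟨D + ∑ _i : Fin n, 2 * C, fun x => ?_⟩
          refine (abs_add_le _ _).trans (add_le_add (hD x) ?_)
          refine (Finset.abs_sum_le_sum_abs _ _).trans (Finset.sum_le_sum fun i _ => ?_)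
          rw [abs_mul, abs_two]
          linarith [hC (a i) x]
      _ = _ := by
          rw [Finset.expect_comm]
          simp only [add_comm, add_left_comm]

end Comparison

/-! ### Hahn–Banach duality for the approximate rank. -/

open Matrix in
/-- Duality between Gelfand and Kolmogorov widths: if `Y` is small in sup norm on the part of the
`ℓ¹` ball killed by `A`, then `Y` is entrywise close to a matrix vanishing on the kernel of `A`. -/
theorem approxRank_le_rank_of_ker {d p n : ℕ} (Y : Matrix (Fin d) (Fin p) ℝ)
    (A : Matrix (Fin n) (Fin p) ℝ) {ε : ℝ} (hε : 0 ≤ ε)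
    (h : ∀ v : Fin p → ℝ, A *ᵥ v = 0 → ∀ i, (Y *ᵥ v) i ≤ ε * ∑ j, |v j|) :
    approxRank ε Y ≤ A.rank := by
  have hext : ∀ i, ∃ g : (Fin p → ℝ) →ₗ[ℝ] ℝ,
      (∀ v, A *ᵥ v = 0 → g v = (Y *ᵥ v) i) ∧ ∀ v, g v ≤ ε * ∑ j, |v j| := by
    intro i
    -- Row `i` of `Y`, restricted to the kernel of `A`, is dominated by `ε‖·‖₁`. The extensions form
    -- the error matrix `E` with entries at most `ε`, and `Y - E` kills that kernel.
    obtain ⟨g, hg, hgN⟩ := exists_extension_of_le_sublinear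
      ⟨LinearMap.ker A.mulVecLin,
        (LinearMap.proj i ∘ₗ Y.mulVecLin).domRestrict (LinearMap.ker A.mulVecLin)⟩
      (fun v => ε * ∑ j, |v j|)
      (fun c hc v => by
        simp only [Pi.smul_apply, smul_eq_mul, abs_mul, abs_of_pos hc, ← Finset.mul_sum]
        ring)
      (fun v w => by
        rw [← mul_add, ← Finset.sum_add_distrib]
        exact mul_le_mul_of_nonneg_left (Finset.sum_le_sum fun j _ => abs_add_le _ _) hε)
      (fun v => h v v.2 i)
    exact ⟨g, fun v hv => hg ⟨v, hv⟩, hgN⟩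
  choose g hg hgN using hext
  have hbasis : ∀ i j, |g i (Pi.single j 1)| ≤ ε := by
    intro i j
    have h1 := hgN i (Pi.single j 1)
    have h2 := hgN i (-Pi.single j 1)
    have h3 : ∑ j', |(Pi.single j 1 : Fin p → ℝ) j'| = 1 := by
      rw [Finset.sum_eq_single j (fun b _ hb => by simp [hb]) (by simp)]
      simp
    rw [map_neg] at h2
    simp only [Pi.neg_apply, abs_neg, h3, mul_one] at h1 h2
    exact abs_le.2 ⟨by linarith, h1⟩
  set E : Matrix (Fin d) (Fin p) ℝ := Matrix.of fun i j => g i (Pi.single j 1) with hE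
  have hEv : ∀ v i, (E *ᵥ v) i = g i v := by
    intro v i
    rw [LinearMap.pi_apply_eq_sum_univ (g i) v]
    simp only [Matrix.mulVec, dotProduct, hE, Matrix.of_apply, smul_eq_mul]
    refine Finset.sum_congr rfl fun j _ => ?_
    rw [mul_comm]
    congr 2
    ext j'
    simp [Pi.single_apply, eq_comm]
  have hker : LinearMap.ker A.mulVecLin ≤ LinearMap.ker (Y - E).mulVecLin := by
    intro v hv
    have hv' : A *ᵥ v = 0 := hv
    rw [LinearMap.mem_ker, Matrix.mulVecLin_apply, Matrix.sub_mulVec]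
    ext i
    simp [hEv, hg i v hv']
  have hrank : (Y - E).rank ≤ A.rank := by
    have h1 := A.mulVecLin.finrank_range_add_finrank_ker
    have h2 := (Y - E).mulVecLin.finrank_range_add_finrank_ker
    have h3 := Submodule.finrank_mono hker
    rw [Matrix.rank, Matrix.rank]
    omega
  have hmem : (Y - E).rank ∈ {r : ℕ | ∃ Z : Matrix (Fin d) (Fin p) ℝ,
      (∀ i j, |Y i j - Z i j| ≤ ε) ∧ Z.rank = r} :=
    ⟨Y - E, fun i j => by simpa [hE] using hbasis i j, rfl⟩
  exact (Nat.sInf_le hmem).trans hrank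

/-! ### The low `M*` estimate and its consequence for the approximate rank. -/

section Width

variable {d p : ℕ}

/-- The normalized sum `n ^ (-1/2) ∑ aᵢ` of `n` sign vectors. -/
noncomputable def normalizedSum {n : ℕ} (a : Fin n → Fin d → Bool) : Fin d → ℝ :=
  fun l => (∑ i, boolSign (a i l)) / √n

/-- The expected sup norm of `b ᵥ* Y`, where `b` is the normalized sum of `n` uniformly random sign
vectors; a discrete counterpart of the Gaussian width of the columns of `Y`. -/
noncomputable def rademacherWidth (n : ℕ) (Y : Matrix (Fin d) (Fin p) ℝ) : ℝ :=
  𝔼 a : Fin n → Fin d → Bool, ‖Matrix.vecMul (normalizedSum a) Y‖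

open Matrix in
/-- The low `M*` estimate: a random subspace of codimension `n` meets the absolutely convex hull
of the columns of `Y` in a set of diameter of order `rademacherWidth n Y / √n`. -/
theorem exists_signs_forall_ker_sqrt_le {n : ℕ} (hn : 0 < n) (Y : Matrix (Fin d) (Fin p) ℝ) :
    ∃ a : Fin n → Fin d → Bool, ∀ v : Fin p → ℝ, ∑ j, |v j| ≤ 1 →
      (∀ i, rademacherSum (Y *ᵥ v) (a i) = 0) →
      √n * √(∑ l, (Y *ᵥ v) l ^ 2) ≤ 2 * √3 * rademacherWidth n Y := by
  have hn' : 0 < √(n : ℝ) := by positivity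
  have hnn : √(n : ℝ) * √n = n := Real.mul_self_sqrt (by positivity)
  let T := {v : Fin p → ℝ // ∑ j, |v j| ≤ 1}
  have : Nonempty T := ⟨⟨0, by simp⟩⟩
  let ℓ : (Fin d → Bool) → T → ℝ := fun a v => rademacherSum (Y *ᵥ v.1) a
  have hℓ : ∀ a v, |ℓ a v| ≤ ∑ l, ∑ j, |Y l j| := by
    intro a v
    change |∑ l, boolSign (a l) * (Y *ᵥ v.1) l| ≤ _
    refine (Finset.abs_sum_le_sum_abs _ _).trans (Finset.sum_le_sum fun l _ => ?_)
    rw [abs_mul, abs_boolSign, one_mul]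
    change |∑ j, Y l j * v.1 j| ≤ _
    refine (Finset.abs_sum_le_sum_abs _ _).trans (Finset.sum_le_sum fun j _ => ?_)
    rw [abs_mul]
    refine mul_le_of_le_one_right (abs_nonneg _) (le_trans ?_ v.2)
    exact Finset.single_le_sum (f := fun j => |v.1 j|) (fun _ _ => abs_nonneg _)
      (Finset.mem_univ j)
  have hν : Function.Involutive fun (a : Fin d → Bool) i => !a i := fun a => by simp
  have hcomp := expect_iSup_sum_sub_abs_le hν.toPerm ℓ (fun a v => rademacherSum_not _ a)
    ⟨_, hℓ⟩ n (fun _ => 0) ⟨0, by simp⟩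
  have hright : 𝔼 a : Fin n → Fin d → Bool, ⨆ v, ((0 : ℝ) + ∑ i, 2 * ℓ (a i) v)
      ≤ 2 * √n * rademacherWidth n Y := by
    rw [rademacherWidth, Finset.mul_expect]
    refine Finset.expect_le_expect fun a _ => ciSup_le fun v => ?_
    have h1 : ∑ i, ℓ (a i) v = √n * (normalizedSum a ⬝ᵥ Y *ᵥ v.1) := by
      simp only [ℓ, rademacherSum, dotProduct, normalizedSum]
      rw [Finset.sum_comm, Finset.mul_sum]
      refine Finset.sum_congr rfl fun l _ => ?_
      rw [← Finset.sum_mul]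
      field_simp
    -- Duality of the `ℓ¹` and sup norms.
    have h2 : (normalizedSum a ᵥ* Y) ⬝ᵥ v.1 ≤ ‖normalizedSum a ᵥ* Y‖ := by
      calc (normalizedSum a ᵥ* Y) ⬝ᵥ v.1 ≤ ∑ j, ‖normalizedSum a ᵥ* Y‖ * |v.1 j| := by
            refine Finset.sum_le_sum fun j _ => (le_abs_self _).trans ?_
            rw [abs_mul]
            exact mul_le_mul_of_nonneg_right (norm_le_pi_norm (normalizedSum a ᵥ* Y) j)
              (abs_nonneg _)
        _ ≤ ‖normalizedSum a ᵥ* Y‖ := by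
            rw [← Finset.mul_sum]
            exact mul_le_of_le_one_right (norm_nonneg _) v.2
    rw [zero_add, ← Finset.mul_sum, h1, Matrix.dotProduct_mulVec, mul_assoc]
    gcongr
  obtain ⟨a, -, ha⟩ := Finset.exists_le_of_expect_le Finset.univ_nonempty (hcomp.trans hright)
  refine ⟨a, fun v hv hker => ?_⟩
  have hbdd : BddAbove (Set.range fun v : T => (0 : ℝ) + ∑ i, (𝔼 a', |ℓ a' v| - |ℓ (a i) v|)) := by
    refine ⟨∑ _i : Fin n, ∑ l, ∑ j, |Y l j|, ?_⟩
    rintro _ ⟨v, rfl⟩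
    refine (zero_add _).trans_le (Finset.sum_le_sum fun i _ => ?_)
    have := Finset.expect_le Finset.univ_nonempty fun a' (_ : a' ∈ Finset.univ) => hℓ a' v
    linarith [abs_nonneg (ℓ (a i) v)]
  -- At a `v` killed by all the sign vectors the subtracted terms vanish, leaving `n` times the mean
  -- of `|ℓ|`, which Khinchine bounds below.
  have h1 := (le_ciSup hbdd ⟨v, hv⟩).trans ha
  have h2 : ∀ i, ℓ (a i) ⟨v, hv⟩ = 0 := hker
  simp only [h2, abs_zero, sub_zero, zero_add, Finset.sum_const, Finset.card_univ,
    Fintype.card_fin, nsmul_eq_mul] at h1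
  have h3 : √(n : ℝ) * 𝔼 a', |ℓ a' ⟨v, hv⟩| ≤ 2 * rademacherWidth n Y := by
    refine le_of_mul_le_mul_left ?_ hn'
    rw [← mul_assoc, hnn]
    linarith
  calc √n * √(∑ l, (Y *ᵥ v) l ^ 2) ≤ √n * (√3 * 𝔼 a', |ℓ a' ⟨v, hv⟩|) := by
        gcongr
        exact sqrt_sum_sq_le_expect_abs _
    _ = √3 * (√n * 𝔼 a', |ℓ a' ⟨v, hv⟩|) := by ring
    _ ≤ √3 * (2 * rademacherWidth n Y) := by gcongr
    _ = _ := by ring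

open Matrix in
/-- A matrix whose columns have small width has small approximate rank. -/
theorem approxRank_le_of_rademacherWidth_le {n : ℕ} (hn : 0 < n) {ε : ℝ} (hε : 0 ≤ ε)
    (Y : Matrix (Fin d) (Fin p) ℝ) (h : 2 * √3 * rademacherWidth n Y ≤ ε * √n) :
    approxRank ε Y ≤ n := by
  have hn' : 0 < √(n : ℝ) := by positivity
  obtain ⟨a, ha⟩ := exists_signs_forall_ker_sqrt_le hn Y
  let G : Matrix (Fin n) (Fin d) ℝ := Matrix.of fun i l => boolSign (a i l)
  refine (approxRank_le_rank_of_ker Y (G * Y) hε fun v hv i => ?_).trans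
    ((Matrix.rank_le_height _))
  set s := ∑ j, |v j| with hs
  have hs0 : 0 ≤ s := Finset.sum_nonneg fun _ _ => abs_nonneg _
  rcases hs0.eq_or_lt with h0 | hpos
  · have : v = 0 := by
      ext j
      have := (Finset.sum_eq_zero_iff_of_nonneg fun _ _ => abs_nonneg _).1 (hs.symm.trans h0.symm)
      exact abs_eq_zero.1 (this j (Finset.mem_univ j))
    simp [this, ← h0]
  · have hker : ∀ i, rademacherSum (Y *ᵥ (s⁻¹ • v)) (a i) = 0 := by
      intro i
      have : (G *ᵥ (Y *ᵥ (s⁻¹ • v))) i = 0 := by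
        rw [Matrix.mulVec_mulVec, Matrix.mulVec_smul, hv]
        simp
      exact this
    have hle := ha (s⁻¹ • v) (by
      simp only [Pi.smul_apply, smul_eq_mul, abs_mul, abs_of_pos (inv_pos.2 hpos),
        ← Finset.mul_sum]
      rw [← hs, inv_mul_cancel₀ hpos.ne']) hker
    have hcoord : (Y *ᵥ (s⁻¹ • v)) i ≤ √(∑ l, (Y *ᵥ (s⁻¹ • v)) l ^ 2) :=
      Real.le_sqrt_of_sq_le (Finset.single_le_sum
        (f := fun l => (Y *ᵥ (s⁻¹ • v)) l ^ 2) (fun _ _ => sq_nonneg _) (Finset.mem_univ i))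
    have hεle : (Y *ᵥ (s⁻¹ • v)) i ≤ ε := by
      refine hcoord.trans (le_of_mul_le_mul_left ?_ hn')
      linarith
    rw [Matrix.mulVec_smul, Pi.smul_apply, smul_eq_mul, inv_mul_le_iff₀ hpos] at hεle
    linarith

end Width

/-! ### Moments of the width statistic: low rank, variance, truncation. -/

section Moments

variable {d p n : ℕ}

/-- Views `n` sign vectors as one point of a larger cube, so that the results on Rademacher sums
apply to normalized sums. -/
lemma expect_curry {ι κ : Type*} [Fintype ι] [Fintype κ] [DecidableEq ι] [DecidableEq κ]
    (f : (ι → κ → Bool) → ℝ) :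
    𝔼 a, f a = 𝔼 ω : ι × κ → Bool, f (Function.curry ω) :=
  (Fintype.expect_equiv (Equiv.curry ι κ Bool) _ _ fun _ => rfl).symm

open Matrix in
lemma normalizedSum_dotProduct (ω : Fin n × Fin d → Bool) (z : Fin d → ℝ) :
    normalizedSum (Function.curry ω) ⬝ᵥ z = rademacherSum (fun x => z x.2 / √n) ω := by
  simp only [dotProduct, normalizedSum, rademacherSum, Fintype.sum_prod_type_right,
    Function.curry_apply, Finset.sum_div, Finset.sum_mul]
  exact Finset.sum_congr rfl fun l _ => Finset.sum_congr rfl fun i _ => by ring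

lemma sum_div_sqrt_sq (hn : 0 < n) (z : Fin d → ℝ) :
    ∑ x : Fin n × Fin d, (z x.2 / √n) ^ 2 = ∑ l, z l ^ 2 := by
  have : (n : ℝ) ≠ 0 := by positivity
  simp only [Fintype.sum_prod_type_right, div_pow, Real.sq_sqrt (Nat.cast_nonneg n),
    Finset.sum_const, Finset.card_univ, Fintype.card_fin, nsmul_eq_mul]
  exact Finset.sum_congr rfl fun l _ => by field_simp

open Matrix in
lemma expect_normalizedSum_dotProduct_sq (hn : 0 < n) (z : Fin d → ℝ) :
    𝔼 a : Fin n → Fin d → Bool, (normalizedSum a ⬝ᵥ z) ^ 2 = ∑ l, z l ^ 2 := by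
  rw [expect_curry]
  simp only [normalizedSum_dotProduct]
  rw [expect_rademacherSum_sq, sum_div_sqrt_sq hn]

lemma expect_norm_vecMul_sq_le (hn : 0 < n) (hp : 0 < p) (Y : Matrix (Fin d) (Fin p) ℝ)
    (hY : ∀ j, ∑ l, Y l j ^ 2 ≤ 1) :
    𝔼 a : Fin n → Fin d → Bool, ‖Matrix.vecMul (normalizedSum a) Y‖ ^ 2
      ≤ rademacherWidth n Y ^ 2 + 2 := by
  have : Nonempty (Fin p) := ⟨⟨0, hp⟩⟩
  have hvec : ∀ ω : Fin n × Fin d → Bool, Matrix.vecMul (normalizedSum (Function.curry ω)) Y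
      = fun j => rademacherSum (fun x => Y x.2 j / √n) ω := fun ω => by
    ext j
    exact normalizedSum_dotProduct ω fun l => Y l j
  rw [rademacherWidth, expect_curry, expect_curry]
  simp only [hvec]
  refine expect_norm_rademacherSum_sq_le _ fun j => ?_
  rw [sum_div_sqrt_sq hn fun l => Y l j]
  exact hY j

lemma finrank_span_range_eq_rank (y : Fin p → EuclideanSpace ℝ (Fin d)) :
    Module.finrank ℝ (Submodule.span ℝ (Set.range y)) = (columnMatrix y).rank := by
  have h : (Submodule.span ℝ (Set.range y)).map (WithLp.linearEquiv 2 ℝ (Fin d → ℝ)).toLinearMap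
      = Submodule.span ℝ (Set.range (columnMatrix y).col) := by
    rw [Submodule.map_span, ← Set.range_comp]
    rfl
  rw [Matrix.rank_eq_finrank_span_cols, ← h]
  exact (LinearEquiv.finrank_map_eq _ _).symm

/-- The width of unit vectors spanning a space of dimension `k` is at most `√k`. -/
theorem rademacherWidth_le_sqrt_rank (hn : 0 < n) (y : Fin p → EuclideanSpace ℝ (Fin d))
    (hy : ∀ j, ‖y j‖ = 1) :
    rademacherWidth n (columnMatrix y) ≤ √((columnMatrix y).rank : ℝ) := by
  set S := Submodule.span ℝ (Set.range y) with hS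
  let B := stdOrthonormalBasis ℝ S
  have hpt : ∀ a : Fin n → Fin d → Bool,
      ‖Matrix.vecMul (normalizedSum a) (columnMatrix y)‖ ^ 2
        ≤ ∑ s, (normalizedSum a ⬝ᵥ (B s : EuclideanSpace ℝ (Fin d)).ofLp) ^ 2 := by
    intro a
    set u : EuclideanSpace ℝ (Fin d) := WithLp.toLp 2 (normalizedSum a) with hu
    have hinner : ∀ w : EuclideanSpace ℝ (Fin d), normalizedSum a ⬝ᵥ w.ofLp = inner ℝ u w := by
      intro w
      rw [PiLp.inner_apply]
      simp only [dotProduct, hu, RCLike.inner_apply, conj_trivial]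
      exact Finset.sum_congr rfl fun l _ => mul_comm _ _
    -- Parseval in `S`; each basis vector contributes 1 to the mean square, so the total is `dim S`.
    have hnorm : ‖S.orthogonalProjectionOnto u‖ ^ 2
        = ∑ s, inner ℝ u (B s : EuclideanSpace ℝ (Fin d)) ^ 2 := by
      rw [← B.sum_sq_inner_right]
      refine Finset.sum_congr rfl fun s _ => ?_
      rw [Submodule.inner_orthogonalProjectionOnto_eq_of_mem_left, real_inner_comm]
    simp only [hinner]
    rw [← hnorm]
    refine pow_le_pow_left₀ (norm_nonneg _) ((pi_norm_le_iff_of_nonneg (norm_nonneg _)).2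
      fun j => ?_) 2
    have hj : y j ∈ S := Submodule.subset_span ⟨j, rfl⟩
    calc ‖Matrix.vecMul (normalizedSum a) (columnMatrix y) j‖ = ‖inner ℝ u (y j)‖ :=
          congrArg norm (hinner (y j))
      _ = ‖inner ℝ (⟨y j, hj⟩ : S) (S.orthogonalProjectionOnto u)‖ := by
          rw [Submodule.inner_orthogonalProjectionOnto_eq_of_mem_left, real_inner_comm]
      _ ≤ ‖(⟨y j, hj⟩ : S)‖ * ‖S.orthogonalProjectionOnto u‖ := norm_inner_le_norm _ _
      _ = ‖S.orthogonalProjectionOnto u‖ := by rw [Submodule.coe_norm, hy j, one_mul]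
  have hsecond : 𝔼 a : Fin n → Fin d → Bool,
      ‖Matrix.vecMul (normalizedSum a) (columnMatrix y)‖ ^ 2 ≤ (columnMatrix y).rank := by
    refine (Finset.expect_le_expect fun a _ => hpt a).trans_eq ?_
    rw [Finset.expect_sum_comm]
    simp only [expect_normalizedSum_dotProduct_sq hn]
    have hone : ∀ s, ∑ l, (B s : EuclideanSpace ℝ (Fin d)) l ^ 2 = 1 := fun s => by
      rw [← EuclideanSpace.real_norm_sq_eq, ← Submodule.coe_norm, B.orthonormal.1 s, one_pow]
    simp only [hone]
    rw [← finrank_span_range_eq_rank, ← hS]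
    simp
  refine Real.le_sqrt_of_sq_le (le_trans ?_ hsecond)
  have hjensen := Finset.expect_mul_sq_le_sq_mul_sq (Finset.univ : Finset (Fin n → Fin d → Bool))
    (fun _ => 1) fun a => ‖Matrix.vecMul (normalizedSum a) (columnMatrix y)‖
  simpa [rademacherWidth] using hjensen

/-- Truncating a nonnegative variable of variance at most `2` far above its mean lowers the mean
by a small amount only. -/
lemma le_expect_min {Ω : Type*} [Fintype Ω] [Nonempty Ω] (X : Ω → ℝ) (hX : ∀ ω, 0 ≤ X ω) {r : ℝ}
    (hr : 1 ≤ r) (h1 : 5 / 4 * r ≤ 𝔼 ω, X ω) (h2 : 𝔼 ω, X ω ^ 2 ≤ (𝔼 ω, X ω) ^ 2 + 2) :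
    29 / 25 * r ≤ 𝔼 ω, min (X ω) (10 * r) := by
  set m := 𝔼 ω, X ω with hm
  have hmpos : 0 < m := by linarith
  -- Scaling by `s ≤ 1` brings the mean down to exactly `5/4 r`, so a very large mean does no harm
  -- to the quadratic lower bound below.
  set s := 5 / 4 * r / m with hs
  have hs0 : 0 ≤ s := by positivity
  have hs1 : s ≤ 1 := (div_le_one hmpos).2 h1
  have hsm : s * m = 5 / 4 * r := by rw [hs]; field_simp
  -- The parabola `u - u²/(40r)` peaks at `u = 20r` with value `10r`.
  have hpt : ∀ ω, s * X ω - s ^ 2 * X ω ^ 2 / (40 * r) ≤ min (X ω) (10 * r) := by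
    intro ω
    have hsX : s * X ω ≤ X ω := mul_le_of_le_one_left (hX ω) hs1
    refine le_min (le_trans (sub_le_self _ (by positivity)) hsX) ?_
    rw [sub_le_iff_le_add, ← sub_le_iff_le_add', le_div_iff₀ (by positivity)]
    nlinarith [sq_nonneg (s * X ω - 20 * r)]
  have hsum := Finset.expect_le_expect (s := Finset.univ) fun ω _ => hpt ω
  rw [Finset.expect_sub_distrib, ← Finset.mul_expect, ← Finset.expect_div, ← Finset.mul_expect,
    ← hm, hsm] at hsum
  have hE : s ^ 2 * 𝔼 ω, X ω ^ 2 ≤ 57 / 16 * r ^ 2 := by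
    calc s ^ 2 * 𝔼 ω, X ω ^ 2 ≤ s ^ 2 * (m ^ 2 + 2) := by gcongr
      _ = (s * m) ^ 2 + 2 * s ^ 2 := by ring
      _ ≤ 57 / 16 * r ^ 2 := by rw [hsm]; nlinarith
  have hdiv : (s ^ 2 * 𝔼 ω, X ω ^ 2) / (40 * r) ≤ 9 / 100 * r := by
    rw [div_le_iff₀ (by positivity)]
    nlinarith
  linarith

end Moments

/-! ### The tester and its error probabilities. -/

section Tester

open MeasureTheory ProbabilityTheory

/-- Hoeffding's inequality for independent copies of a bounded random variable. -/
lemma measureReal_pi_sum_ge_le {E : Type*} [MeasurableSpace E] (μ : Measure E)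
    [IsProbabilityMeasure μ] {f : E → ℝ} (hf : Measurable f) {a b : ℝ}
    (hab : ∀ x, f x ∈ Set.Icc a b) (q : ℕ) {t : ℝ} (ht : 0 ≤ t) :
    (Measure.pi fun _ : Fin q => μ).real {M | q * (∫ x, f x ∂μ + t) ≤ ∑ i, f (M i)}
      ≤ Real.exp (-(2 * q * t ^ 2) / (b - a) ^ 2) := by
  rcases Nat.eq_zero_or_pos q with rfl | hq
  · simp
  have hsub : HasSubgaussianMGF (fun x => f x - ∫ x, f x ∂μ) ((‖b - a‖₊ / 2) ^ 2) μ :=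
    hasSubgaussianMGF_of_mem_Icc hf.aemeasurable (.of_forall hab)
  have hindep : iIndepFun (fun (i : Fin q) (M : Fin q → E) => f (M i) - ∫ x, f x ∂μ)
      (Measure.pi fun _ => μ) :=
    iIndepFun_pi (X := fun _ x => f x - ∫ x, f x ∂μ)
      fun _ => (hf.sub_const _).aemeasurable
  have hsub' : ∀ i ∈ (Finset.univ : Finset (Fin q)),
      HasSubgaussianMGF (fun M : Fin q → E => f (M i) - ∫ x, f x ∂μ) ((‖b - a‖₊ / 2) ^ 2)
        (Measure.pi fun _ => μ) := by
    intro i _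
    have hmp := measurePreserving_eval (fun _ : Fin q => μ) i
    refine HasSubgaussianMGF.of_map (Y := fun M : Fin q → E => M i)
      (X := fun x => f x - ∫ x, f x ∂μ) hmp.measurable.aemeasurable ?_
    rw [hmp.map_eq]
    exact hsub
  have hoeffding := HasSubgaussianMGF.measure_sum_ge_le_of_iIndepFun hindep hsub' (ε := q * t)
    (by positivity)
  simp only [Finset.sum_sub_distrib, Finset.sum_const, Finset.card_univ, Fintype.card_fin,
    nsmul_eq_mul, le_sub_iff_add_le'] at hoeffding
  simp only [mul_add]
  refine hoeffding.trans_eq ?_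
  congr 1
  push_cast
  rw [Real.norm_eq_abs, div_pow, sq_abs]
  rcases eq_or_ne (b - a) 0 with h | h
  · simp [h]
  · field_simp

/-- The law of the normalized sum of `n` independent uniformly random sign vectors. -/
noncomputable def rowLaw (n d : ℕ) : Measure (Fin d → ℝ) :=
  (PMF.uniformOfFintype (Fin n → Fin d → Bool)).toMeasure.map normalizedSum

instance (n d : ℕ) : IsProbabilityMeasure (rowLaw n d) :=
  Measure.isProbabilityMeasure_map (Measurable.of_discrete).aemeasurable

lemma integral_rowLaw (n d : ℕ) {f : (Fin d → ℝ) → ℝ} (hf : Measurable f) :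
    ∫ b, f b ∂rowLaw n d = 𝔼 a : Fin n → Fin d → Bool, f (normalizedSum a) := by
  rw [rowLaw, integral_map (Measurable.of_discrete).aemeasurable hf.aestronglyMeasurable,
    PMF.integral_eq_sum, Fintype.expect_eq_sum_div_card, Finset.sum_div]
  refine Finset.sum_congr rfl fun a _ => ?_
  rw [PMF.uniformOfFintype_apply, ENNReal.toReal_inv, ENNReal.toReal_natCast, smul_eq_mul]
  ring

/-- The tester that accepts when the truncated sup norms of the rows of the sketch are small on
average. -/
noncomputable def truncatedWidthTester (d p q n : ℕ) (r : ℝ) : LinearTester d p q where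
  law := Measure.pi fun _ => rowLaw n d
  isProbabilityMeasure_law := inferInstance
  accept := {S | ∑ a, min ‖S a‖ (10 * r) ≤ q * (27 / 25 * r)}
  measurableSet_accept := measurableSet_le (by fun_prop) (by fun_prop)

variable {d p n : ℕ}

lemma measurable_min_norm_vecMul (Y : Matrix (Fin d) (Fin p) ℝ) (t : ℝ) :
    Measurable fun b : Fin d → ℝ => min ‖Matrix.vecMul b Y‖ t := by
  have : Continuous fun b : Fin d → ℝ => Matrix.vecMul b Y :=
    (Matrix.vecMulLinear Y).continuous_of_finiteDimensional
  fun_prop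

lemma one_sub_le_of_forall_or {Ω : Type*} [MeasurableSpace Ω] (μ : Measure Ω)
    [IsProbabilityMeasure μ] {s t : Set Ω} (h : ∀ ω, ω ∈ s ∨ ω ∈ t) {δ : ℝ} (ht : μ.real t ≤ δ) :
    1 - δ ≤ μ.real s := by
  have h1 : μ.real (s ∪ t) = 1 := by
    rw [show s ∪ t = Set.univ from Set.eq_univ_of_forall h, measureReal_def, measure_univ,
      ENNReal.toReal_one]
  linarith [measureReal_union_le (μ := μ) s t]

/-- Truncation only lowers the mean, so the threshold `27/25 r` lies at least `2/25 r` above it.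
Hoeffding with range `10r` gives exponent `8q/62500 ≥ q/10000`. -/
theorem one_sub_le_probAccept (q : ℕ) {r : ℝ} (hr : 0 < r) (Y : Matrix (Fin d) (Fin p) ℝ)
    (hY : rademacherWidth n Y ≤ r) :
    1 - Real.exp (-(q / 10000)) ≤ (truncatedWidthTester d p q n r).probAccept Y := by
  have hmeas := measurable_min_norm_vecMul Y (10 * r)
  refine one_sub_le_of_forall_or (Measure.pi fun _ : Fin q => rowLaw n d) ?_
    ((measureReal_pi_sum_ge_le (rowLaw n d) hmeas (a := 0) (b := 10 * r)
      (fun b => ⟨le_min (norm_nonneg _) (by positivity), min_le_right _ _⟩) q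
      (t := 2 / 25 * r) (by positivity)).trans ?_)
  · intro M
    have hint : ∫ b, min ‖Matrix.vecMul b Y‖ (10 * r) ∂rowLaw n d ≤ r := by
      rw [integral_rowLaw n d hmeas]
      exact (Finset.expect_le_expect fun a _ => min_le_left _ _).trans hY
    rcases le_total (∑ i, min ‖Matrix.vecMul (M i) Y‖ (10 * r)) (q * (27 / 25 * r)) with h | h
    · exact Or.inl h
    · right
      refine le_trans ?_ h
      gcongr
      linarith
  · rw [Real.exp_le_exp]
    have : -(2 * q * (2 / 25 * r) ^ 2) / (10 * r - 0) ^ 2 = -(q * (8 / 62500)) := by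
      field_simp
      ring
    rw [this]
    linarith [(Nat.cast_nonneg q : (0 : ℝ) ≤ q)]

/-- By `le_expect_min` the truncated mean is at least `29/25 r`, again `2/25 r` from the threshold;
Hoeffding is applied to the negated statistic. -/
theorem one_sub_le_probReject (hn : 0 < n) (hp : 0 < p) (q : ℕ) {r : ℝ} (hr : 1 ≤ r)
    (Y : Matrix (Fin d) (Fin p) ℝ) (hcol : ∀ j, ∑ l, Y l j ^ 2 ≤ 1)
    (hY : 5 / 4 * r ≤ rademacherWidth n Y) :
    1 - Real.exp (-(q / 10000)) ≤ (truncatedWidthTester d p q n r).probReject Y := by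
  have hmeas := measurable_min_norm_vecMul Y (10 * r)
  refine one_sub_le_of_forall_or (Measure.pi fun _ : Fin q => rowLaw n d) ?_
    ((measureReal_pi_sum_ge_le (rowLaw n d) hmeas.neg (a := -(10 * r)) (b := 0)
      (fun b => ⟨neg_le_neg (min_le_right _ _),
        neg_nonpos.2 (le_min (norm_nonneg _) (by positivity))⟩) q
      (t := 2 / 25 * r) (by positivity)).trans ?_)
  · intro M
    have hint : 29 / 25 * r ≤ ∫ b, min ‖Matrix.vecMul b Y‖ (10 * r) ∂rowLaw n d := by
      rw [integral_rowLaw n d hmeas]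
      exact le_expect_min _ (fun _ => norm_nonneg _) hr hY
        (expect_norm_vecMul_sq_le hn hp Y hcol)
    by_cases h : ∑ i, min ‖Matrix.vecMul (M i) Y‖ (10 * r) ≤ q * (27 / 25 * r)
    · right
      simp only [Set.mem_ofPred_eq, Pi.neg_apply, Finset.sum_neg_distrib, integral_neg]
      have : (q : ℝ) * (-∫ b, min ‖Matrix.vecMul b Y‖ (10 * r) ∂rowLaw n d + 2 / 25 * r)
          ≤ q * -(27 / 25 * r) := by
        gcongr
        linarith
      linarith
    · exact Or.inl h
  · rw [Real.exp_le_exp]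
    have : -(2 * q * (2 / 25 * r) ^ 2) / (0 - -(10 * r)) ^ 2 = -(q * (8 / 62500)) := by
      field_simp
      ring
    rw [this]
    linarith [(Nat.cast_nonneg q : (0 : ℝ) ≤ q)]

end Tester

/-! ### Choice of parameters. -/

theorem theorem1p3 :
    ∃ C : ℝ, 0 < C ∧
      ∀ (ε δ : ℝ) (d k p : ℕ), 0 < ε → ε < 1 → 0 < δ → δ < 1 → 0 < d → 0 < k → 0 < p →
        10 * ε ^ 2 * Real.log (d : ℝ) ≤ (k : ℝ) →
        ∃ (q : ℕ) (T : LinearTester d p q), q ≤ ⌈C * Real.log (1 / δ)⌉₊ ∧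
          ∀ y : Fin p → EuclideanSpace ℝ (Fin d), (∀ j, ‖y j‖ = 1) →
            ((columnMatrix y).rank ≤ k → 1 - δ ≤ T.probAccept (columnMatrix y)) ∧
            (20 * (k : ℝ) / ε ^ 2 ≤ (approxRank ε (columnMatrix y) : ℝ) →
              1 - δ ≤ T.probReject (columnMatrix y)) := by
  refine ⟨10000, by norm_num, fun ε δ d k p hε hε1 hδ _ _ hk hp _ => ?_⟩
  set q := ⌈10000 * Real.log (1 / δ)⌉₊ with hq
  have hk1 : (1 : ℝ) ≤ k := by exact_mod_cast hk
  have hεsq : ε ^ 2 ≤ 1 := pow_le_one₀ hε.le hε1.le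
  have hkε : (1 : ℝ) ≤ k / ε ^ 2 := by
    rw [le_div_iff₀ (by positivity)]
    linarith
  -- `n` is the largest integer strictly below `20k/ε²`, so approximate rank at most `n` contradicts
  -- the soundness hypothesis; it is still at least `19k/ε²`.
  obtain ⟨n, hn⟩ : ∃ n, ⌈20 * (k : ℝ) / ε ^ 2⌉₊ = n + 1 :=
    Nat.exists_eq_succ_of_ne_zero (Nat.ceil_pos.2 (by positivity)).ne'
  have hn_lt : (n : ℝ) < 20 * k / ε ^ 2 := Nat.lt_ceil.1 (by omega)
  have hn_ge : 19 * (k : ℝ) / ε ^ 2 ≤ n := by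
    have := Nat.le_ceil (20 * (k : ℝ) / ε ^ 2)
    rw [hn] at this
    push_cast at this
    rw [mul_div_assoc] at this ⊢
    linarith
  have hn0 : 0 < n := by
    have : (0 : ℝ) < n := lt_of_lt_of_le (by positivity) hn_ge
    exact_mod_cast this
  have hexp : Real.exp (-(q / 10000)) ≤ δ := by
    rw [← Real.le_log_iff_exp_le hδ]
    have := Nat.le_ceil (10000 * Real.log (1 / δ))
    rw [← hq, one_div, Real.log_inv] at this
    linarith
  refine ⟨q, truncatedWidthTester d p q n √k, le_rfl,
    fun y hy => ⟨fun hrank => ?_, fun hrank => ?_⟩⟩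
  · refine le_trans (by linarith) (one_sub_le_probAccept q (by positivity) _
      ((rademacherWidth_le_sqrt_rank hn0 y hy).trans ?_))
    gcongr
  · refine le_trans (by linarith) (one_sub_le_probReject hn0 hp q (Real.one_le_sqrt.2 hk1) _
      (fun j => ?_) ?_)
    · have := EuclideanSpace.real_norm_sq_eq (y j)
      rw [hy j] at this
      simp [columnMatrix, ← this]
    · by_contra! hW
      have hle : approxRank ε (columnMatrix y) ≤ n := by
        refine approxRank_le_of_rademacherWidth_le hn0 hε.le _ ?_
        calc 2 * √3 * rademacherWidth n (columnMatrix y) ≤ 2 * √3 * (5 / 4 * √k) := by gcongr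
          _ ≤ ε * √n := by
            -- After squaring, the left side is `12 · (25/16) k = 18.75 k`, below `19k ≤ ε² n`.
            refine abs_le_of_sq_le_sq' ?_ (by positivity) |>.2
            simp only [mul_pow, Real.sq_sqrt (Nat.cast_nonneg _),
              Real.sq_sqrt (by norm_num : (0 : ℝ) ≤ 3)]
            rw [div_le_iff₀ (by positivity)] at hn_ge
            linarith
      have : (approxRank ε (columnMatrix y) : ℝ) ≤ n := by exact_mod_cast hle
      linarith
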